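/- Let $G$ be a countably infinite amenable group, i.e. one that has a Følner sequence: a sequence $(F_n)$ of non-empty finite subsets of $G$ with $|KF_n\,\triangle\,F_n|/|F_n|\to 0$ for every non-empty finite $K\subset G$. A $G$-subshift $(X,R)$ is a closed subset $X\subset\mathcal A^G$ ($\mathcal A$ a finite discrete alphabet, product topology) that is invariant under the shift action $(\sigma^g x)(h)=x(hg)$, with $R^g=\sigma^g|_X$; a factor map is a continuous surjection commuting with the actions. For a factor map $\pi:X\to Y$ from $(X,T)$ to $(Y,S)$, the topological conditional entropy is $$h(T\mid S)=\sup_{\mathcal U}\ \limsup_{n}\ \frac1{|F_n|}\log\sup_{y\in Y}N\bigl(\mathcal U_{F_n}\mid\pi^{-1}(y)\bigr),\qquad \mathcal U_{F}=\bigvee_{g\in F}T^{g^{-1}}\mathcal U,$$ where $\mathcal U$ ranges over the finite open covers of $X$, $N(\mathcal V\mid K)$ is the minimal cardinality of a subfamily of $\mathcal V$ that covers $K$, and $(F_n)$ is a Følner sequence (the upper limit is in fact a limit and does not depend on the Følner sequence). **Proposition 5.1.** Let $(X,R)$ be a non-empty $G$-subshift. Then for every $\epsilon\in(0,1/2)$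 there are an integer $M\ge 0$, $G$-subshifts $(X_0,R_0),\dots,(X_{M+1},R_{M+1})$ (over possibly different finite alphabets) and factor maps $\varphi_{m+1}:X_m\to X_{m+1}$ for $0\le m\le M$ such that $(X_0,R_0)=(X,R)$, $(X_{M+1},R_{M+1})$ is the one-point system, and, along every Følner sequence of $G$, $h(R_m\mid R_{m+1})<\epsilon$ for all $0\le m\le M$. -/

import Mathlib

open scoped Pointwise

universe u v

/-- A Foelner sequence of a group `G`: non-empty finite sets `F n` such that for every non-empty
finite `K ⊆ G` one has `|K F n ∆ F n| / |F n| → 0`. -/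
structure IsFolnerSeq {G : Type v} [Group G] (F : ℕ → Finset G) : Prop where
  nonempty : ∀ n, (F n).Nonempty
  tendsto : ∀ K : Finset G, K.Nonempty →
    Filter.Tendsto
      (fun n => (Set.ncard (symmDiff ((K : Set G) * (F n : Set G)) (F n : Set G)) : ℝ)
        / ((F n).card : ℝ))
      Filter.atTop (nhds 0)

/-- Amenability of a (countable) group, as the existence of a Foelner sequence. -/
def IsAmenableGroup (G : Type v) [Group G] : Prop :=
  ∃ F : ℕ → Finset G, IsFolnerSeq F

/-- A `G`-subshift: a finite (discrete) alphabet together with a closed subset of the full shift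
`Alphabet ^ G` (product topology) that is invariant under `(σ^g x)(h) = x (h g)`. -/
structure GSubshift (G : Type v) [Group G] where
  Alphabet : Type u
  [finite : Finite Alphabet]
  [top : TopologicalSpace Alphabet]
  [discrete : DiscreteTopology Alphabet]
  carrier : Set (G → Alphabet)
  isClosed : IsClosed carrier
  shift_mem : ∀ (g : G), ∀ x ∈ carrier, (fun h => x (h * g)) ∈ carrier

attribute [instance] GSubshift.finite GSubshift.top GSubshift.discrete

/-- The shift action of `G` on the points of a subshift, `(g • x)(h) = x (h g)`. -/
instance GSubshift.instMulAction {G : Type v} [Group G] (X : GSubshift.{u, v} G) :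
    MulAction G X.carrier where
  smul g x := ⟨fun h => x.1 (h * g), X.shift_mem g x.1 x.2⟩
  one_smul x := Subtype.ext (funext fun h => congrArg x.1 (mul_one h))
  mul_smul g k x := Subtype.ext (funext fun h => congrArg x.1 (mul_assoc h g k).symm)

/-- Factor maps between `G`-systems: continuous equivariant surjections. -/
structure IsFactorMap (G : Type*) [Group G] {X Y : Type*} [TopologicalSpace X]
    [TopologicalSpace Y] [MulAction G X] [MulAction G Y] (π : X → Y) : Prop where
  continuous : Continuous π
  surjective : Function.Surjective π
  map_smul : ∀ (g : G) (x : X), π (g • x) = g • π x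

/-- `𝒰` is a finite open cover of `X`. -/
structure IsFiniteOpenCover {X : Type*} [TopologicalSpace X] (𝒰 : Set (Set X)) : Prop where
  finite : 𝒰.Finite
  isOpen : ∀ U ∈ 𝒰, IsOpen U
  sUnion_eq : ⋃₀ 𝒰 = Set.univ

/-- The join `𝒰_F = ⋁_{g ∈ F} T^{g⁻¹} 𝒰`, whose members are the intersections
`⋂_{g ∈ F} T^{g⁻¹} U_g` with `U_g ∈ 𝒰`; note that `T^{g⁻¹} U_g` is the preimage of `U_g`
under `T^g`. -/
def coverJoin {G : Type*} [Group G] {X : Type*} [MulAction G X] (𝒰 : Set (Set X))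
    (F : Finset G) : Set (Set X) :=
  {V | ∃ U : G → Set X, (∀ g ∈ F, U g ∈ 𝒰) ∧ V = ⋂ g ∈ F, (fun x => g • x) ⁻¹' U g}

/-- `N(𝒱 | K)`: the minimal cardinality of a finite subfamily of `𝒱` that covers `K`. -/
noncomputable def coverNumber {X : Type*} (𝒱 : Set (Set X)) (K : Set X) : ℕ∞ :=
  ⨅ (s : Finset (Set X)) (_ : (s : Set (Set X)) ⊆ 𝒱 ∧ K ⊆ ⋃₀ (s : Set (Set X))), (s.card : ℕ∞)

/-- `h(T, 𝒰 | S)` along the sequence `F`: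
`lim_n (1 / |F n|) log sup_y N(𝒰_{F n} | π⁻¹ y)`. It is written as an upper limit, which equals
the limit whenever that exists. -/
noncomputable def condEntropyCover {G : Type*} [Group G] {X Y : Type*} [MulAction G X]
    (F : ℕ → Finset G) (π : X → Y) (𝒰 : Set (Set X)) : EReal :=
  Filter.limsup
    (fun n => ENNReal.log ((⨆ y : Y, coverNumber (coverJoin 𝒰 (F n)) (π ⁻¹' {y}) : ℕ∞) : ENNReal)
      / ((F n).card : EReal))
    Filter.atTop

/-- The topological conditional entropy `h(T | S) = sup_𝒰 h(T, 𝒰 | S)` of a factor map `π`, the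
supremum being over all finite open covers of `X`. -/
noncomputable def condEntropy {G : Type*} [Group G] {X Y : Type*} [TopologicalSpace X]
    [MulAction G X] (F : ℕ → Finset G) (π : X → Y) : EReal :=
  ⨆ (𝒰 : Set (Set X)) (_ : IsFiniteOpenCover 𝒰), condEntropyCover F π 𝒰

open Filter Topology

/-! Fix a large `m`. Points whose orbits have fewer than `m` elements show very few patterns on
windows `T⁻¹ * T` with `T` large inside a subgroup having few generators
(`ncard_pattern_smallOrbits_le`). All other points are governed by a clopen marker `C`
(`exists_marker`): visits of an orbit to `C` have density of order at most `1/m`, while every point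
whose window pattern does not occur on a small orbit lies in a translate of `C` by some element of a
finite set `L`.

The block code `eraseRule` keeps the visits to `C` and deletes the symbols at `L`-translates of
visits. Enlarging `L` by one element deletes symbols only along one translate of the visits, which
costs conditional entropy of order `log |alphabet| / m`, whatever the size of `L`
(`HasChain.eraseFactor_of_insert`). Starting from `L = ∅`, where nothing is lost, finitely many such
steps delete all of `L`.

What remains has small entropy (`hasChain_eraseFactor`): the visits are sparse, and a symbol
survives only where the surrounding window shows a pattern from a small orbit. So the last factor
may be mapped to a point. The constants are chosen in the order `l`, `m`, `r`, and only then `C`,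
`K`, `L`; the sizes of `K` and `L` are harmless because a Følner set absorbs any fixed finite set.
-/

/-! ### Elementary counting. -/

theorem Set.ncard_image_le_of_factor {α β γ : Type*} {a : α → β} {b : α → γ} {s : Set α}
    (hfin : (b '' s).Finite) (h : ∀ x ∈ s, ∀ y ∈ s, b x = b y → a x = a y) :
    (a '' s).ncard ≤ (b '' s).ncard := by
  rcases s.eq_empty_or_nonempty with rfl | ⟨x₀, hx₀⟩
  · simp
  have : Nonempty α := ⟨x₀⟩
  have hsub : a '' s ⊆ (fun q => a (Function.invFunOn b s q)) '' (b '' s) := by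
    rintro _ ⟨x, hx, rfl⟩
    refine ⟨b x, ⟨x, hx, rfl⟩, ?_⟩
    have hex : ∃ y ∈ s, b y = b x := ⟨x, hx, rfl⟩
    exact h _ (Function.invFunOn_mem hex) _ hx (Function.invFunOn_eq hex)
  exact (Set.ncard_le_ncard hsub (hfin.image _)).trans (Set.ncard_image_le hfin)

/-- Chernoff's argument: each counted set `t` has weight `exp (l * (q - t.card)) ≥ 1`, and over all
subsets the weights sum to `exp (l * q) * (1 + exp (-l)) ^ s.card`. It bounds the number of sparse
visit sets. -/
theorem Finset.card_filter_card_le_le_exp {α : Type*} (s : Finset α) (q l : ℝ) (hl : 0 ≤ l) :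
    ((s.powerset.filter fun t => (t.card : ℝ) ≤ q).card : ℝ)
      ≤ Real.exp (l * q + s.card * Real.exp (-l)) := by
  have h1 : ((s.powerset.filter fun t => (t.card : ℝ) ≤ q).card : ℝ)
      ≤ ∑ t ∈ s.powerset, Real.exp (l * q) * Real.exp (-l) ^ t.card := by
    rw [Finset.card_eq_sum_ones, Nat.cast_sum, Nat.cast_one]
    refine (Finset.sum_le_sum ?_).trans
      (Finset.sum_le_sum_of_subset_of_nonneg (Finset.filter_subset _ _) ?_)
    · intro t ht
      have ht := (Finset.mem_filter.1 ht).2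
      rw [← Real.exp_nat_mul, ← Real.exp_add]
      refine Real.one_le_exp ?_
      nlinarith
    · intros; positivity
  refine h1.trans ?_
  have h2 : ∑ t ∈ s.powerset, Real.exp (-l) ^ t.card = (Real.exp (-l) + 1) ^ s.card := by
    have := Finset.sum_pow_mul_eq_add_pow (Real.exp (-l)) 1 s
    simpa using this
  rw [← Finset.mul_sum, h2, Real.exp_add, Real.exp_nat_mul]
  gcongr
  exact Real.add_one_le_exp _

/-! ### Boundaries of Følner sets. -/

section Folner

variable {G : Type v} [Group G] [DecidableEq G]

theorem IsFolnerSeq.eventually_card_mul_sdiff_le {F : ℕ → Finset G} (hF : IsFolnerSeq F)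
    (K : Finset G) {δ : ℝ} (hδ : 0 < δ) :
    ∀ᶠ n in atTop, (((K * F n) \ F n).card : ℝ) ≤ δ * (F n).card := by
  rcases K.eq_empty_or_nonempty with rfl | hK
  · simp only [Finset.empty_mul, Finset.empty_sdiff, Finset.card_empty, Nat.cast_zero]
    exact Eventually.of_forall fun n => by positivity
  filter_upwards [(hF.tendsto K hK).eventually_lt_const hδ] with n hn
  have hpos : (0 : ℝ) < (F n).card := by exact_mod_cast (hF.nonempty n).card_pos
  rw [div_lt_iff₀ hpos] at hn
  refine le_trans ?_ hn.le
  have hfin : (symmDiff ((K : Set G) * (F n : Set G)) (F n : Set G)).Finite := by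
    rw [← Finset.coe_mul, ← Finset.coe_symmDiff]
    exact Finset.finite_toSet _
  rw [← Set.ncard_coe_finset]
  refine Nat.cast_le.2 (Set.ncard_le_ncard ?_ hfin)
  rw [Finset.coe_sdiff, Finset.coe_mul]
  exact fun x hx => Or.inl hx

theorem IsFolnerSeq.eventually_card_mul_le {F : ℕ → Finset G} (hF : IsFolnerSeq F)
    (K : Finset G) : ∀ᶠ n in atTop, ((K * F n).card : ℝ) ≤ 2 * (F n).card := by
  filter_upwards [hF.eventually_card_mul_sdiff_le K one_pos] with n hn
  have h : (K * F n).card ≤ ((K * F n) \ F n).card + (F n).card := by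
    exact Finset.card_le_card_sdiff_add_card
  have h : ((K * F n).card : ℝ) ≤ ((K * F n) \ F n).card + (F n).card := by exact_mod_cast h
  linarith

end Folner

/-! ### Conditional entropy through patterns in fibres. -/

namespace GSubshift

variable {G : Type v} [Group G]

instance (X : GSubshift.{u, v} G) : CompactSpace X.carrier :=
  isCompact_iff_compactSpace.1 X.isClosed.isCompact

theorem smul_apply (X : GSubshift.{u, v} G) (g h : G) (x : X.carrier) :
    (g • x).1 h = x.1 (h * g) := rfl

instance (X : GSubshift.{u, v} G) : ContinuousConstSMul G X.carrier :=
  ⟨fun g => continuous_induced_rng.2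
    (continuous_pi fun h => (continuous_apply (h * g)).comp continuous_subtype_val)⟩

/-- The restriction of a point to a finite set of coordinates. -/
def pattern (X : GSubshift.{u, v} G) (E : Finset G) (x : X.carrier) : E → X.Alphabet :=
  fun g => x.1 g

theorem pattern_eq_iff (X : GSubshift.{u, v} G) {E : Finset G} {x y : X.carrier} :
    X.pattern E x = X.pattern E y ↔ ∀ g ∈ E, x.1 g = y.1 g := by
  simp [pattern, funext_iff]

theorem eventually_pattern_eq (X : GSubshift.{u, v} G) (E : Finset G) (x : X.carrier) :
    ∀ᶠ y in 𝓝 x, X.pattern E y = X.pattern E x := by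
  simp only [pattern_eq_iff]
  rw [Filter.eventually_all_finset]
  intro g _
  have hc : Continuous fun y : X.carrier => y.1 g :=
    (continuous_apply g).comp continuous_subtype_val
  exact hc.continuousAt.eventually_mem
    ((isOpen_discrete ({x.1 g} : Set X.Alphabet)).mem_nhds rfl)

theorem exists_pattern_subset (X : GSubshift.{u, v} G) {U : Set X.carrier} {x : X.carrier}
    (hU : U ∈ 𝓝 x) : ∃ E : Finset G, ∀ y, X.pattern E y = X.pattern E x → y ∈ U := by
  rw [nhds_subtype_eq_comap, Filter.mem_comap] at hU
  obtain ⟨W, hW, hWU⟩ := hU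
  rw [nhds_pi, Filter.mem_pi] at hW
  obtain ⟨I, hI, t, ht, hsub⟩ := hW
  refine ⟨hI.toFinset, fun y hy => hWU (hsub fun i hi => ?_)⟩
  rw [pattern_eq_iff] at hy
  rw [hy i (by simpa using hi)]
  exact mem_of_mem_nhds (ht i)

/-- A finite coordinate window that resolves an open cover. -/
theorem exists_pattern_subordinate (X : GSubshift.{u, v} G) {𝒰 : Set (Set X.carrier)}
    (h𝒰 : IsFiniteOpenCover 𝒰) :
    ∃ E : Finset G, ∀ x, ∃ U ∈ 𝒰, ∀ y, X.pattern E y = X.pattern E x → y ∈ U := by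
  classical
  suffices h : ∃ E : Finset G, ∀ x ∈ (Set.univ : Set X.carrier),
      ∃ U ∈ 𝒰, ∀ y, X.pattern E y = X.pattern E x → y ∈ U by simpa using h
  refine isCompact_univ.induction_on (p := fun s => ∃ E : Finset G, ∀ x ∈ s,
      ∃ U ∈ 𝒰, ∀ y, X.pattern E y = X.pattern E x → y ∈ U) ⟨∅, by simp⟩ ?_ ?_ ?_
  · rintro s t hst ⟨E, hE⟩
    exact ⟨E, fun x hx => hE x (hst hx)⟩
  · rintro s t ⟨E, hE⟩ ⟨E', hE'⟩
    refine ⟨E ∪ E', ?_⟩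
    rintro x (hx | hx)
    · obtain ⟨U, hU, h⟩ := hE x hx
      refine ⟨U, hU, fun y hy => h y ?_⟩
      rw [pattern_eq_iff] at hy ⊢
      exact fun g hg => hy g (Finset.mem_union_left _ hg)
    · obtain ⟨U, hU, h⟩ := hE' x hx
      refine ⟨U, hU, fun y hy => h y ?_⟩
      rw [pattern_eq_iff] at hy ⊢
      exact fun g hg => hy g (Finset.mem_union_right _ hg)
  · intro x _
    obtain ⟨U, hU, hxU⟩ : ∃ U ∈ 𝒰, x ∈ U := by
      have : x ∈ ⋃₀ 𝒰 := h𝒰.sUnion_eq ▸ Set.mem_univ x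
      simpa using this
    obtain ⟨E, hE⟩ := X.exists_pattern_subset ((h𝒰.isOpen U hU).mem_nhds hxU)
    refine ⟨_, mem_nhdsWithin_of_mem_nhds (X.eventually_pattern_eq E x), E, ?_⟩
    exact fun z hz => ⟨U, hU, fun y hy => hE y (hy.trans hz)⟩

theorem ncard_pattern_image_le [DecidableEq G] (X : GSubshift.{u, v} G) (E E' : Finset G)
    (s : Set X.carrier) :
    (X.pattern E' '' s).ncard
      ≤ (X.pattern E '' s).ncard * Nat.card X.Alphabet ^ (E' \ E).card := by
  have h1 : (X.pattern E' '' s).ncard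
      ≤ ((fun x => (X.pattern E x, X.pattern (E' \ E) x)) '' s).ncard := by
    refine Set.ncard_image_le_of_factor (Set.toFinite _) fun x _ y _ hxy => ?_
    rw [Prod.mk.injEq, pattern_eq_iff, pattern_eq_iff] at hxy
    rw [pattern_eq_iff]
    intro g hg
    by_cases hgE : g ∈ E
    · exact hxy.1 g hgE
    · exact hxy.2 g (Finset.mem_sdiff.2 ⟨hg, hgE⟩)
  refine h1.trans ?_
  have h2 : ((fun x => (X.pattern E x, X.pattern (E' \ E) x)) '' s)
      ⊆ (X.pattern E '' s) ×ˢ (Set.univ : Set (↥(E' \ E) → X.Alphabet)) := by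
    rintro _ ⟨x, hx, rfl⟩
    exact ⟨⟨x, hx, rfl⟩, trivial⟩
  refine (Set.ncard_le_ncard h2 (Set.toFinite _)).trans ?_
  rw [Set.ncard_prod, Set.ncard_univ, Nat.card_fun, Nat.card_eq_fintype_card (α := ↥(E' \ E)),
    Fintype.card_coe]

/-- The pattern of `x` on `E * F` determines that of `g • x` on `E` for every `g ∈ F`, so one member
of the join serves all points sharing that pattern. -/
theorem coverNumber_coverJoin_le [DecidableEq G] (X : GSubshift.{u, v} G)
    {𝒰 : Set (Set X.carrier)} {E : Finset G}
    (hE : ∀ x, ∃ U ∈ 𝒰, ∀ y, X.pattern E y = X.pattern E x → y ∈ U) (F : Finset G)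
    (s : Set X.carrier) :
    coverNumber (coverJoin 𝒰 F) s ≤ ((X.pattern (E * F) '' s).ncard : ℕ∞) := by
  choose U hU hUE using hE
  let V : X.carrier → Set X.carrier := fun x => ⋂ g ∈ F, (fun y => g • y) ⁻¹' U (g • x)
  have hV : ∀ x y, X.pattern (E * F) y = X.pattern (E * F) x → y ∈ V x := by
    intro x y hxy
    simp only [V, Set.mem_iInter, Set.mem_preimage]
    intro g hg
    refine hUE _ _ ?_
    rw [pattern_eq_iff] at hxy ⊢
    exact fun e he => hxy _ (Finset.mul_mem_mul he hg)
  have hsec : ∀ p : X.pattern (E * F) '' s, ∃ x ∈ s, X.pattern (E * F) x = p := fun p => p.2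
  choose r _ hr using hsec
  have hfin : (Set.range fun p => V (r p)).Finite := Set.toFinite _
  have hcov : (hfin.toFinset : Set (Set X.carrier)) ⊆ coverJoin 𝒰 F ∧
      s ⊆ ⋃₀ (hfin.toFinset : Set (Set X.carrier)) := by
    rw [hfin.coe_toFinset]
    constructor
    · rintro _ ⟨p, rfl⟩
      exact ⟨fun g => U (g • r p), fun g _ => hU _, rfl⟩
    · intro x hx
      refine ⟨_, ⟨⟨_, x, hx, rfl⟩, rfl⟩, hV _ _ ?_⟩
      rw [hr]
  refine (iInf₂_le hfin.toFinset hcov).trans ?_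
  rw [← Set.ncard_eq_toFinset_card _ hfin]
  have := Set.ncard_image_le (f := fun p => V (r p)) (s := Set.univ) Set.finite_univ
  rw [Set.image_univ, Set.ncard_univ] at this
  exact_mod_cast this

/-- Conditional entropy is bounded by the exponential growth rate of the numbers of patterns in
the fibres. -/
theorem condEntropy_le {Y : Type*} (X : GSubshift.{u, v} G) {F : ℕ → Finset G}
    (hF : IsFolnerSeq F) (π : X.carrier → Y) (c : ℝ)
    (h : ∀ᶠ n in atTop, ∀ y, ((X.pattern (F n) '' (π ⁻¹' {y})).ncard : ℝ)
      ≤ Real.exp (c * (F n).card)) : condEntropy F π ≤ c := by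
  classical
  refine iSup₂_le fun 𝒰 h𝒰 => ?_
  obtain ⟨E, hE⟩ := X.exists_pattern_subordinate h𝒰
  rw [← EReal.le_of_forall_lt_iff_le]
  intro z hz
  rw [EReal.coe_lt_coe_iff] at hz
  obtain ⟨b, hb⟩ : ∃ b : ℝ, b = Nat.card X.Alphabet := ⟨_, rfl⟩
  have hb0 : 0 ≤ b := hb ▸ Nat.cast_nonneg _
  -- For `z > c`, passing from `F n` to `E * F n` costs a factor `b ^ (δ |F n|) ≤ exp (b δ |F n|)`;
  -- this `δ` keeps it below `exp ((z - c) |F n|)`, and `b + 1` keeps the denominator positive.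
  have hδ : 0 < (z - c) / (b + 1) := div_pos (by linarith) (by linarith)
  refine Filter.limsup_le_of_le (by isBoundedDefault) ?_
  filter_upwards [h, hF.eventually_card_mul_sdiff_le E hδ] with n hn hEn
  have hpos : (0 : ℝ) < (F n).card := by exact_mod_cast (hF.nonempty n).card_pos
  have key : ∀ y, ((X.pattern (E * F n) '' (π ⁻¹' {y})).ncard : ℝ)
      ≤ Real.exp (z * (F n).card) := by
    intro y
    have h1 : ((X.pattern (E * F n) '' (π ⁻¹' {y})).ncard : ℝ)
        ≤ (X.pattern (F n) '' (π ⁻¹' {y})).ncard * b ^ ((E * F n) \ F n).card := by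
      rw [hb]
      exact_mod_cast X.ncard_pattern_image_le (F n) (E * F n) (π ⁻¹' {y})
    refine h1.trans ?_
    have h2 : b ^ ((E * F n) \ F n).card ≤ Real.exp ((z - c) * (F n).card) := by
      have hbe : b ≤ Real.exp b := by linarith [Real.add_one_le_exp b]
      refine (pow_le_pow_left₀ hb0 hbe _).trans ?_
      rw [← Real.exp_nat_mul, Real.exp_le_exp]
      calc (((E * F n) \ F n).card : ℝ) * b
          ≤ ((z - c) / (b + 1) * (F n).card) * (b + 1) := by gcongr; linarith
        _ = (z - c) * (F n).card := by field_simp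
    calc _ ≤ Real.exp (c * (F n).card) * Real.exp ((z - c) * (F n).card) := by
          gcongr
          exact hn y
      _ = Real.exp (z * (F n).card) := by rw [← Real.exp_add]; ring_nf
  -- The supremum over fibres is taken in `ℕ∞`, so the real bound enters through its integer part.
  have hsup : (⨆ y : Y, coverNumber (coverJoin 𝒰 (F n)) (π ⁻¹' {y}))
      ≤ (⌊Real.exp (z * (F n).card)⌋₊ : ℕ∞) := by
    refine iSup_le fun y => (X.coverNumber_coverJoin_le hE (F n) _).trans ?_
    exact_mod_cast Nat.le_floor (key y)
  have hlog : ENNReal.log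
      ((⨆ y : Y, coverNumber (coverJoin 𝒰 (F n)) (π ⁻¹' {y}) : ℕ∞) : ENNReal)
      ≤ ((z * (F n).card : ℝ) : EReal) := by
    rw [← Real.log_exp (z * (F n).card), ← ENNReal.log_ofReal_of_pos (Real.exp_pos _)]
    refine ENNReal.log_monotone ((ENat.toENNReal_le.2 hsup).trans ?_)
    rw [ENat.toENNReal_coe, ← ENNReal.ofReal_natCast]
    exact ENNReal.ofReal_le_ofReal (Nat.floor_le (Real.exp_pos _).le)
  refine (EReal.div_le_div_right_of_nonneg (by positivity) hlog).trans ?_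
  have : ((F n).card : EReal) = (((F n).card : ℝ) : EReal) := by simp
  rw [this, ← EReal.coe_div, EReal.coe_le_coe_iff, mul_div_cancel_right₀ _ hpos.ne']

end GSubshift

/-! ### Block codes and chains of factor maps. -/

namespace GSubshift

variable {G : Type v} [Group G]

/-- The image of a subshift under the block code given by a locally constant function. -/
def blockFactor (X : GSubshift.{u, v} G) {B : Type u} [Finite B] (f : X.carrier → B)
    (hf : IsLocallyConstant f) : GSubshift.{u, v} G where
  Alphabet := B
  top := ⊥
  discrete := @DiscreteTopology.mk B ⊥ rfl
  carrier := Set.range fun (x : X.carrier) (g : G) => f (g • x)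
  isClosed := by
    let _ : TopologicalSpace B := ⊥
    have : DiscreteTopology B := ⟨rfl⟩
    exact (isCompact_range
      (continuous_pi fun g => hf.continuous.comp (continuous_const_smul g))).isClosed
  shift_mem := by
    rintro g _ ⟨x, rfl⟩
    exact ⟨g • x, funext fun h => congrArg f (smul_smul h g x)⟩

/-- The block code onto `X.blockFactor f hf`. -/
def blockMap (X : GSubshift.{u, v} G) {B : Type u} [Finite B] (f : X.carrier → B)
    (hf : IsLocallyConstant f) (x : X.carrier) : (X.blockFactor f hf).carrier :=
  ⟨fun g => f (g • x), x, rfl⟩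

theorem blockMap_eq_iff (X : GSubshift.{u, v} G) {B : Type u} [Finite B] {f : X.carrier → B}
    (hf : IsLocallyConstant f) {x y : X.carrier} :
    X.blockMap f hf x = X.blockMap f hf y ↔ ∀ g : G, f (g • x) = f (g • y) := by
  rw [Subtype.ext_iff, funext_iff]
  rfl

theorem isFactorMap_blockMap (X : GSubshift.{u, v} G) {B : Type u} [Finite B]
    (f : X.carrier → B) (hf : IsLocallyConstant f) : IsFactorMap G (X.blockMap f hf) where
  continuous := by
    refine continuous_induced_rng.2 (continuous_pi fun g => ?_)
    let _ : TopologicalSpace B := (X.blockFactor f hf).top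
    exact hf.continuous.comp (continuous_const_smul g)
  surjective := by
    rintro ⟨_, x, rfl⟩
    exact ⟨x, rfl⟩
  map_smul g x := Subtype.ext (funext fun h => by
    change f (h • g • x) = f ((h * g) • x)
    rw [smul_smul])

theorem exists_isFactorMap_of_ker_le {X Y W : GSubshift.{u, v} G}
    {p : X.carrier → Y.carrier} {q : X.carrier → W.carrier} (hp : IsFactorMap G p)
    (hq : IsFactorMap G q) (h : ∀ x x', p x = p x' → q x = q x') :
    ∃ π : Y.carrier → W.carrier, IsFactorMap G π ∧ ∀ x, π (p x) = q x := by
  choose r hr using hp.surjective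
  have hπ : ∀ x, q (r (p x)) = q x := fun x => h _ _ (hr _)
  refine ⟨fun y => q (r y), ⟨?_, ?_, ?_⟩, hπ⟩
  · have hquot := (hp.continuous.isClosedMap).isQuotientMap hp.continuous hp.surjective
    rw [hquot.continuous_iff]
    exact hq.continuous.congr fun x => (hπ x).symm
  · intro w
    obtain ⟨x, rfl⟩ := hq.surjective w
    exact ⟨p x, hπ x⟩
  · intro g y
    obtain ⟨x, rfl⟩ := hp.surjective y
    rw [← hp.map_smul, hπ, hπ, hq.map_smul]

/-- `X` is connected to the one-point system by finitely many factor maps of conditional entropy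
less than `ε`. -/
def HasChain (ε : ℝ) (X : GSubshift.{u, v} G) : Prop :=
  ∃ (M : ℕ) (Z : Fin (M + 2) → GSubshift.{u, v} G)
    (φ : ∀ m : Fin (M + 1), (Z m.castSucc).carrier → (Z m.succ).carrier),
    Z 0 = X ∧
    (∃ p, (Z (Fin.last (M + 1))).carrier = {p}) ∧
    (∀ m, IsFactorMap G (φ m)) ∧
    ∀ m, ∀ F : ℕ → Finset G, IsFolnerSeq F → condEntropy F (φ m) < (ε : EReal)

theorem HasChain.cons {ε : ℝ} {X Y : GSubshift.{u, v} G} (hY : HasChain ε Y)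
    {π : X.carrier → Y.carrier} (hπ : IsFactorMap G π)
    (h : ∀ F : ℕ → Finset G, IsFolnerSeq F → condEntropy F π < (ε : EReal)) :
    HasChain ε X := by
  obtain ⟨M, Z, φ, rfl, hlast, hfac, hent⟩ := hY
  refine ⟨M + 1, Fin.cons X Z, Fin.cases π fun m => φ m, rfl, hlast, ?_, ?_⟩
  · intro m
    induction m using Fin.cases with
    | zero => exact hπ
    | succ m => exact hfac m
  · intro m
    induction m using Fin.cases with
    | zero => exact h
    | succ m => exact hent m

/-- The one-point subshift. -/
def point (G : Type v) [Group G] : GSubshift.{u, v} G where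
  Alphabet := PUnit
  top := ⊥
  discrete := @DiscreteTopology.mk PUnit ⊥ rfl
  carrier := Set.univ
  isClosed := by
    let _ : TopologicalSpace PUnit.{u + 1} := ⊥
    exact isClosed_univ
  shift_mem _ _ _ := trivial

theorem hasChain_of_pattern_bound {ε c : ℝ} (hc : c < ε) {X : GSubshift.{u, v} G}
    (hX : X.carrier.Nonempty)
    (h : ∀ F : ℕ → Finset G, IsFolnerSeq F → ∀ᶠ n in atTop,
      ((X.pattern (F n) '' Set.univ).ncard : ℝ) ≤ Real.exp (c * (F n).card)) :
    HasChain ε X := by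
  have hX' : Nonempty X.carrier := hX.to_subtype
  let q : (point.{u, v} G).carrier := ⟨fun _ => PUnit.unit, trivial⟩
  have hq : ∀ y, y = q := fun y => Subtype.ext (funext fun _ => rfl)
  refine ⟨0, Fin.cons X fun _ => point G, Fin.cases (fun _ => q) fun m => m.elim0, rfl,
    ⟨q.1, ?_⟩, ?_, ?_⟩
  · exact Set.eq_singleton_iff_unique_mem.2 ⟨trivial, fun y _ => funext fun _ => rfl⟩
  · intro m
    obtain rfl : m = 0 := Fin.fin_one_eq_zero m
    exact ⟨continuous_const, fun y => ⟨hX'.some, (hq y).symm⟩,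
      fun g x => (hq _).symm⟩
  · intro m F hF
    obtain rfl : m = 0 := Fin.fin_one_eq_zero m
    refine lt_of_le_of_lt (X.condEntropy_le hF (fun _ => q) c ?_) (EReal.coe_lt_coe_iff.2 hc)
    filter_upwards [h F hF] with n hn y
    refine le_trans (Nat.cast_le.2 (Set.ncard_le_ncard ?_ (Set.toFinite _))) hn
    exact Set.image_mono (Set.subset_univ _)

theorem HasChain.cons_of_pattern_bound {ε c : ℝ} (hc : c < ε) {X Y : GSubshift.{u, v} G}
    (hY : HasChain ε Y) {π : X.carrier → Y.carrier} (hπ : IsFactorMap G π)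
    (h : ∀ F : ℕ → Finset G, IsFolnerSeq F → ∀ᶠ n in atTop, ∀ y,
      ((X.pattern (F n) '' (π ⁻¹' {y})).ncard : ℝ) ≤ Real.exp (c * (F n).card)) :
    HasChain ε X :=
  hY.cons hπ fun F hF =>
    lt_of_le_of_lt (X.condEntropy_le hF π c (h F hF)) (EReal.coe_lt_coe_iff.2 hc)

end GSubshift

/-! ### Packed sets and their translates. -/

section Packing

variable {G : Type v} [Group G] {α : Type*} [MulAction G α]

/-- Visits of an orbit to `C` carry pairwise disjoint translates of `m`-element subsets of `K`. -/
def IsPacked (C : Set α) (m : ℕ) (K : Finset G) : Prop :=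
  ∃ κ : α → Finset G, (∀ x ∈ C, (κ x).card = m ∧ κ x ⊆ K) ∧
    ∀ x ∈ C, ∀ g : G, g • x ∈ C → ∀ k ∈ κ x, ∀ k' ∈ κ (g • x), k = k' * g → g = 1

/-- The union of the translates of `C` by the elements of `L`. -/
def translates (L : Finset G) (C : Set α) : Set α :=
  {x | ∃ l ∈ L, l⁻¹ • x ∈ C}

theorem translates_mono {L L' : Finset G} (h : L ⊆ L') (C : Set α) :
    translates L C ⊆ translates L' C := fun _ ⟨l, hl, hx⟩ => ⟨l, h hl, hx⟩

theorem isClopen_translates [TopologicalSpace α] [ContinuousConstSMul G α] (L : Finset G)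
    {C : Set α} (hC : IsClopen C) : IsClopen (translates L C) := by
  have : translates L C = ⋃ l ∈ L, (fun x => l⁻¹ • x) ⁻¹' C := by
    ext x
    simp [translates]
  rw [this]
  exact L.finite_toSet.isClopen_biUnion fun l _ => hC.preimage (continuous_const_smul _)

variable [DecidableEq G]

open Classical in
-- The sets `κ (g • x) * g`, over the visits `g ∈ F`, are disjoint, have `m` elements each and lie
-- in `K * F`. Hence visits have density of order at most `1 / m` along a Følner sequence.
theorem IsPacked.mul_card_visits_le {C : Set α} {m : ℕ} {K : Finset G} (h : IsPacked C m K)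
    (x : α) (F : Finset G) : m * (F.filter fun g => g • x ∈ C).card ≤ (K * F).card := by
  obtain ⟨κ, hκ, hdisj⟩ := h
  have hsig : ((F.filter fun g => g • x ∈ C).sigma fun g => κ (g • x)).card
      = m * (F.filter fun g => g • x ∈ C).card := by
    rw [Finset.card_sigma, Finset.sum_congr rfl fun g hg =>
      (hκ _ (Finset.mem_filter.1 hg).2).1, Finset.sum_const, smul_eq_mul, mul_comm]
  rw [← hsig]
  refine Finset.card_le_card_of_injOn (fun p => p.2 * p.1) ?_ ?_
  · rintro ⟨g, k⟩ hp
    simp only [Finset.coe_sigma, Set.mem_sigma_iff, Finset.mem_coe, Finset.mem_filter] at hp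
    exact Finset.mul_mem_mul ((hκ _ hp.1.2).2 hp.2) hp.1.1
  · rintro ⟨g, k⟩ hp ⟨g', k'⟩ hp' heq
    simp only [Finset.coe_sigma, Set.mem_sigma_iff, Finset.mem_coe, Finset.mem_filter] at hp hp'
    dsimp only at heq
    have hg' : (g' * g⁻¹) • g • x = g' • x := by rw [smul_smul, inv_mul_cancel_right]
    have h1 : g' * g⁻¹ = 1 := by
      refine hdisj _ hp.1.2 (g' * g⁻¹) (hg' ▸ hp'.1.2) k hp.2 k' (hg' ▸ hp'.2) ?_
      rw [← mul_assoc, ← heq, mul_inv_cancel_right]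
    obtain rfl : g' = g := mul_inv_eq_one.1 h1
    obtain rfl : k = k' := mul_right_cancel heq
    rfl

/-- A collision between a `C₁`-visit and a `C₂`-visit forces their displacement into `K₂⁻¹ * K₁` or
its inverse; dropping the `C₂`-visits that near to `C₁` removes all mixed collisions. -/
theorem IsPacked.union_diff_translates {C₁ C₂ : Set α} {m : ℕ} {K₁ K₂ : Finset G}
    (h₁ : IsPacked C₁ m K₁) (h₂ : IsPacked C₂ m K₂) :
    IsPacked (C₁ ∪ (C₂ \ translates (K₂⁻¹ * K₁) C₁)) m (K₁ ∪ K₂) := by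
  classical
  obtain ⟨κ₁, hκ₁, hd₁⟩ := h₁
  obtain ⟨κ₂, hκ₂, hd₂⟩ := h₂
  refine ⟨fun x => if x ∈ C₁ then κ₁ x else κ₂ x, ?_, ?_⟩
  · rintro x hx
    by_cases hx₁ : x ∈ C₁
    · simp only [hx₁, if_true]
      exact ⟨(hκ₁ x hx₁).1, (hκ₁ x hx₁).2.trans Finset.subset_union_left⟩
    · simp only [hx₁, if_false]
      have hx₂ := (hx.resolve_left hx₁).1
      exact ⟨(hκ₂ x hx₂).1, (hκ₂ x hx₂).2.trans Finset.subset_union_right⟩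
  · intro x hx g hgx k hk k' hk' hkk'
    by_cases hx₁ : x ∈ C₁ <;> by_cases hg₁ : g • x ∈ C₁ <;>
      simp only [hx₁, hg₁, if_true, if_false] at hk hk'
    · exact hd₁ x hx₁ g hg₁ k hk k' hk' hkk'
    · have hg₂ := hgx.resolve_left hg₁
      refine absurd ⟨g, ?_, by rwa [inv_smul_smul]⟩ hg₂.2
      rw [show g = k'⁻¹ * k by rw [hkk', inv_mul_cancel_left]]
      exact Finset.mul_mem_mul (Finset.inv_mem_inv ((hκ₂ _ hg₂.1).2 hk')) ((hκ₁ x hx₁).2 hk)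
    · have hx₂ := hx.resolve_left hx₁
      refine absurd ⟨g⁻¹, ?_, by rwa [inv_inv]⟩ hx₂.2
      rw [show g⁻¹ = k⁻¹ * k' by rw [hkk', mul_inv_rev, inv_mul_cancel_right]]
      exact Finset.mul_mem_mul (Finset.inv_mem_inv ((hκ₂ _ hx₂.1).2 hk)) ((hκ₁ _ hg₁).2 hk')
    · exact hd₂ x (hx.resolve_left hx₁).1 g (hgx.resolve_left hg₁).1 k hk k' hk' hkk'

/-- A dropped `C₂`-visit is within `L` of a `C₁`-visit, so the points it served are reached through
`L₂ * L` instead. -/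
theorem subset_translates_union_diff {C₁ C₂ s t : Set α} {L L₁ L₂ : Finset G}
    (hs : s ⊆ translates L₁ C₁) (ht : t ⊆ translates L₂ C₂) :
    s ∪ t ⊆ translates (L₁ ∪ L₂ ∪ L₂ * L) (C₁ ∪ (C₂ \ translates L C₁)) := by
  rintro x (hx | hx)
  · obtain ⟨l, hl, hlx⟩ := hs hx
    exact ⟨l, by simp [hl], Or.inl hlx⟩
  · obtain ⟨l, hl, hlx⟩ := ht hx
    by_cases h : l⁻¹ • x ∈ translates L C₁
    · obtain ⟨l', hl', hlx'⟩ := h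
      refine ⟨l * l', Finset.mem_union_right _ (Finset.mul_mem_mul hl hl'), Or.inl ?_⟩
      rwa [mul_inv_rev, mul_smul]
    · exact ⟨l, by simp [hl], Or.inr ⟨hlx, h⟩⟩

end Packing

/-! ### Clopen markers. -/

namespace GSubshift

variable {G : Type v} [Group G]

theorem isClopen_pattern_eq (X : GSubshift.{u, v} G) (E : Finset G) (x : X.carrier) :
    IsClopen {y | X.pattern E y = X.pattern E x} := by
  refine ⟨isOpen_compl_iff.1 (isOpen_iff_mem_nhds.2 fun y hy => ?_),
    isOpen_iff_mem_nhds.2 fun y hy => ?_⟩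
  · filter_upwards [X.eventually_pattern_eq E y] with z hz
    exact fun h => hy (hz.symm.trans h)
  · filter_upwards [X.eventually_pattern_eq E y] with z hz
    exact hz.trans hy

/-- Finitely many coordinates of `x` witness that the points `k • x` are distinct; take for `C` the
cylinder around `x` on those coordinates. -/
theorem exists_isPacked_nhds (X : GSubshift.{u, v} G) (x : X.carrier) {K : Finset G}
    (hK : Set.InjOn (fun k : G => k • x) K) :
    ∃ C : Set X.carrier, IsClopen C ∧ x ∈ C ∧ IsPacked C K.card K := by
  classical
  have hsep : ∀ k k' : G, ∃ h : G, k ∈ K → k' ∈ K → k ≠ k' → x.1 (h * k) ≠ x.1 (h * k') := by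
    intro k k'
    by_contra! hcon
    have h1 := hcon 1
    refine h1.2.2.1 (hK h1.1 h1.2.1 (Subtype.ext (funext fun h => ?_)))
    exact (hcon h).2.2.2
  choose h hh using hsep
  let E : Finset G := (K ×ˢ K).image (fun p => h p.1 p.2 * p.1)
    ∪ (K ×ˢ K).image (fun p => h p.1 p.2 * p.2)
  refine ⟨_, X.isClopen_pattern_eq E x, rfl, fun _ => K, fun _ _ => ⟨rfl, subset_rfl⟩, ?_⟩
  intro y hy g hgy k hk k' hk' hkk'
  rw [Set.mem_ofPred_eq, pattern_eq_iff] at hy hgy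
  by_contra hg
  have hne : k ≠ k' := fun h => hg (by simpa [h] using hkk')
  -- Since `k = k' * g`, the symbol of `y` at `h * k` is that of `g • y` at `h * k'`. Both points
  -- agree with `x` on `E`, so `x` would take equal values at the separating coordinates.
  refine hh k k' hk hk' hne ?_
  have hkk : (k, k') ∈ K ×ˢ K := Finset.mem_product.2 ⟨hk, hk'⟩
  have e1 := hy (h k k' * k) (Finset.mem_union_left _ (Finset.mem_image.2 ⟨_, hkk, rfl⟩))
  have e2 := hgy (h k k' * k') (Finset.mem_union_right _ (Finset.mem_image.2 ⟨_, hkk, rfl⟩))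
  rw [smul_apply, mul_assoc, ← hkk'] at e2
  exact e1.symm.trans e2

/-- Away from the points with small orbits there are clopen markers: sparse sets visited
syndetically. -/
theorem exists_marker (X : GSubshift.{u, v} G) (m : ℕ) {s : Set X.carrier} (hs : IsCompact s)
    (h : ∀ x ∈ s, ∃ K : Finset G, K.card = m ∧ Set.InjOn (fun k : G => k • x) K) :
    ∃ (C : Set X.carrier) (K L : Finset G),
      IsClopen C ∧ IsPacked C m K ∧ s ⊆ translates L C := by
  classical
  refine hs.induction_on (p := fun s => ∃ (C : Set X.carrier) (K L : Finset G),
      IsClopen C ∧ IsPacked C m K ∧ s ⊆ translates L C) ?_ ?_ ?_ ?_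
  · exact ⟨∅, ∅, ∅, isClopen_empty, ⟨fun _ => ∅, by simp, by simp⟩, Set.empty_subset _⟩
  · rintro s t hst ⟨C, K, L, hC, hK, hL⟩
    exact ⟨C, K, L, hC, hK, hst.trans hL⟩
  · rintro s t ⟨C₁, K₁, L₁, hC₁, hK₁, hL₁⟩ ⟨C₂, K₂, L₂, hC₂, hK₂, hL₂⟩
    exact ⟨_, _, _, hC₁.union (hC₂.diff (isClopen_translates _ hC₁)),
      hK₁.union_diff_translates hK₂, subset_translates_union_diff hL₁ hL₂⟩
  · intro x hx
    obtain ⟨K, rfl, hK⟩ := h x hx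
    obtain ⟨C, hC, hxC, hp⟩ := X.exists_isPacked_nhds x hK
    refine ⟨C, mem_nhdsWithin_of_mem_nhds (hC.isOpen.mem_nhds hxC), C, K, {1}, hC, hp, ?_⟩
    exact fun y hy => ⟨1, Finset.mem_singleton_self 1, by simpa using hy⟩

end GSubshift

/-! ### Few patterns on small orbits. -/

/-- While the generated subgroup is proper, a new generator `s` outside it makes `s * T` disjoint
from `T`, doubling `T`; once it is the whole infinite group, any set of the required size will do.
Exponential size against linearly many generators makes the entropy of small orbits negligible. -/
theorem exists_card_eq_two_pow_subset_closure (G : Type*) [Group G] [Infinite G] (r : ℕ) :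
    ∃ S T : Finset G, S.card ≤ r ∧ (T : Set G) ⊆ Subgroup.closure (S : Set G) ∧
      T.card = 2 ^ r := by
  classical
  induction r with
  | zero => exact ⟨∅, {1}, by simp, by simp, by simp⟩
  | succ r ih =>
    obtain ⟨S, T, hS, hT, hTc⟩ := ih
    by_cases htop : Subgroup.closure (S : Set G) = ⊤
    · obtain ⟨T', hT'⟩ := Infinite.exists_subset_card_eq G (2 ^ (r + 1))
      exact ⟨S, T', hS.trans (Nat.le_succ r), by simp [htop], hT'⟩
    · obtain ⟨s, hs⟩ : ∃ s, s ∉ Subgroup.closure (S : Set G) := by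
        by_contra! h
        exact htop (eq_top_iff.2 fun x _ => h x)
      have hle : Subgroup.closure (S : Set G) ≤ Subgroup.closure ((insert s S : Finset G) : Set G) :=
        Subgroup.closure_mono (by simp)
      refine ⟨insert s S, T ∪ T.image (s * ·), ?_, ?_, ?_⟩
      · exact (Finset.card_insert_le _ _).trans (by omega)
      · intro x hx
        rw [Finset.mem_coe, Finset.mem_union, Finset.mem_image] at hx
        rcases hx with hx | ⟨t, ht, rfl⟩
        · exact hle (hT hx)
        · exact mul_mem (Subgroup.subset_closure (by simp)) (hle (hT ht))
      · rw [Finset.card_union_of_disjoint, Finset.card_image_of_injective _ (mul_right_injective s),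
          hTc, pow_succ, mul_two]
        rw [Finset.disjoint_left]
        intro x hx hx'
        obtain ⟨t, ht, rfl⟩ := Finset.mem_image.1 hx'
        exact hs ((Subgroup.mul_mem_cancel_right _ (hT ht)).1 (hT hx))

namespace GSubshift

variable {G : Type v} [Group G]

/-- The points whose orbit has fewer than `m` elements. -/
def smallOrbits (X : GSubshift.{u, v} G) (m : ℕ) : Set X.carrier :=
  {x | ¬ ∃ K : Finset G, K.card = m ∧ Set.InjOn (fun k : G => k • x) K}

theorem exists_injOn_orbit_of_mem_smallOrbits (X : GSubshift.{u, v} G) {m : ℕ} {z : X.carrier}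
    (hz : z ∈ X.smallOrbits m) :
    ∃ idx : X.carrier → Fin m, Set.InjOn idx (MulAction.orbit G z) := by
  classical
  have hlt : (MulAction.orbit G z).encard < m := by
    by_contra! hcon
    obtain ⟨t, ht, htc⟩ := Set.exists_subset_encard_eq hcon
    have htf : t.Finite := Set.finite_of_encard_eq_coe htc
    have : ∀ y : t, ∃ g : G, g • z = y := fun y => ht y.2
    choose r hr using this
    have : Fintype t := htf.fintype
    have hri : Function.Injective r := fun y y' h => Subtype.ext (by rw [← hr, ← hr, h])
    refine hz ⟨Finset.univ.image r, ?_, ?_⟩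
    · rw [Finset.card_image_of_injective _ hri, Finset.card_univ, ← Nat.card_eq_fintype_card,
        Nat.card_coe_set_eq, Set.ncard, htc]
      rfl
    · intro k hk k' hk' h
      simp only [Finset.coe_image, Finset.coe_univ, Set.image_univ, Set.mem_range] at hk hk'
      obtain ⟨y, rfl⟩ := hk
      obtain ⟨y', rfl⟩ := hk'
      simp only [hr] at h
      rw [Subtype.ext h]
  have hfin : (MulAction.orbit G z).Finite :=
    Set.encard_lt_top_iff.1 (hlt.trans_le le_top)
  have : Fintype (MulAction.orbit G z) := hfin.fintype
  have hcard : Fintype.card (MulAction.orbit G z) < m := by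
    rw [← Nat.card_eq_fintype_card, Nat.card_coe_set_eq]
    rw [← hfin.cast_ncard_eq] at hlt
    exact_mod_cast hlt
  obtain ⟨e⟩ : Nonempty (MulAction.orbit G z ↪ Fin m) :=
    Function.Embedding.nonempty_of_card_le (by simpa using hcard.le)
  refine ⟨fun y => if h : y ∈ MulAction.orbit G z then e ⟨y, h⟩ else ⟨0, by omega⟩, ?_⟩
  intro y hy y' hy' h
  simp only [hy, hy', dif_pos] at h
  exact congrArg Subtype.val (e.injective h)

/-- Number the orbit by `Fin m`. How the generators and their inverses permute the numbers, the
symbol at `1` for each number and the number of the starting point together determine the pattern on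
the generated subgroup. -/
theorem ncard_pattern_smallOrbits_le (X : GSubshift.{u, v} G) {m : ℕ} (hm : 0 < m) {S P : Finset G}
    (hP : (P : Set G) ⊆ Subgroup.closure (S : Set G)) :
    (X.pattern P '' X.smallOrbits m).ncard
      ≤ (m ^ m) ^ S.card * (m ^ m) ^ S.card * (Nat.card X.Alphabet ^ m * m) := by
  classical
  let Code := ((S → Fin m → Fin m) × (S → Fin m → Fin m)) × ((Fin m → X.Alphabet) × Fin m)
  have hcode : ∀ z : X.carrier, ∃ c : Code, z ∈ X.smallOrbits m → ∃ idx : X.carrier → Fin m,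
      idx z = c.2.2 ∧ ∀ y ∈ MulAction.orbit G z,
        (∀ s : S, idx ((s : G) • y) = c.1.1 s (idx y)) ∧
        (∀ s : S, idx ((s : G)⁻¹ • y) = c.1.2 s (idx y)) ∧ y.1 1 = c.2.1 (idx y) := by
    intro z
    by_cases hz : z ∈ X.smallOrbits m
    · obtain ⟨idx, hidx⟩ := X.exists_injOn_orbit_of_mem_smallOrbits hz
      have : Nonempty X.carrier := ⟨z⟩
      let r := Function.invFunOn idx (MulAction.orbit G z)
      have hr : ∀ y ∈ MulAction.orbit G z, r (idx y) = y := fun y hy =>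
        hidx.leftInvOn_invFunOn hy
      refine ⟨((fun s j => idx ((s : G) • r j), fun s j => idx ((s : G)⁻¹ • r j)),
        (fun j => (r j).1 1, idx z)), fun _ => ⟨idx, rfl, fun y hy => ?_⟩⟩
      simp only [hr y hy, implies_true, and_self]
    · exact ⟨((fun _ j => j, fun _ j => j), (fun _ => z.1 1, ⟨0, hm⟩)), fun h => absurd h hz⟩
  choose code hcode using hcode
  have h1 : (X.pattern P '' X.smallOrbits m).ncard ≤ (code '' X.smallOrbits m).ncard := by
    refine Set.ncard_image_le_of_factor (Set.toFinite _) fun z hz z' hz' hzz' => ?_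
    obtain ⟨idx, h0, h⟩ := hcode z hz
    obtain ⟨idx', h0', h'⟩ := hcode z' hz'
    rw [← hzz'] at h0' h'
    -- Spelling `g` as a word in the generators, two points with equal codes run through the same
    -- numbers.
    have key : ∀ g ∈ Subgroup.closure (S : Set G), idx (g • z) = idx' (g • z') := by
      intro g hg
      induction hg using Subgroup.closure_induction_left with
      | one => rw [one_smul, one_smul, h0, h0']
      | mul_left s hs g _ ih =>
        rw [mul_smul, mul_smul, (h _ ⟨g, rfl⟩).1 ⟨s, hs⟩, (h' _ ⟨g, rfl⟩).1 ⟨s, hs⟩, ih]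
      | inv_mul_cancel s hs g _ ih =>
        rw [mul_smul, mul_smul, (h _ ⟨g, rfl⟩).2.1 ⟨s, hs⟩, (h' _ ⟨g, rfl⟩).2.1 ⟨s, hs⟩, ih]
    rw [pattern_eq_iff]
    intro g hg
    have e1 := (h _ ⟨g, rfl⟩).2.2
    have e2 := (h' _ ⟨g, rfl⟩).2.2
    simp only [smul_apply, one_mul] at e1 e2
    rw [e1, e2, key g (hP hg)]
  refine (h1.trans (Set.ncard_le_card _)).trans_eq ?_
  simp only [Code, Nat.card_prod, Nat.card_fun, Nat.card_eq_fintype_card (α := Fin m),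
    Nat.card_eq_fintype_card (α := S), Fintype.card_fin, Fintype.card_coe]

end GSubshift

/-! ### Separated sets and visit times. -/

/-- Choose `B` greedily with the translates `T * b` disjoint; a point that cannot be added has a
translate meeting an earlier one, so it lies in `T⁻¹ * T * B`. -/
theorem Finset.exists_separated {G : Type*} [Group G] [DecidableEq G] {T : Finset G}
    (hT : T.Nonempty) (D : Finset G) :
    ∃ B ⊆ D, T.card * B.card ≤ (T * D).card ∧ D ⊆ T⁻¹ * T * B := by
  suffices h : ∃ B ⊆ D, (T * B).card = T.card * B.card ∧ D ⊆ T⁻¹ * T * B by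
    obtain ⟨B, hB, hc, hD⟩ := h
    exact ⟨B, hB, hc ▸ Finset.card_le_card (Finset.mul_subset_mul_left hB), hD⟩
  induction D using Finset.induction_on with
  | empty => exact ⟨∅, by simp⟩
  | insert a D _ ih =>
    obtain ⟨B, hB, hc, hD⟩ := ih
    by_cases ha : a ∈ T⁻¹ * T * B
    · exact ⟨B, hB.trans (Finset.subset_insert _ _), hc, Finset.insert_subset ha hD⟩
    · have haT : ∀ b : G, a ∈ T⁻¹ * T * {b} ↔ ∃ x ∈ T * {a}, x ∈ T * {b} := by
        intro b
        simp only [Finset.mem_mul, Finset.mem_inv, Finset.mem_singleton]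
        constructor
        · rintro ⟨_, ⟨_, ⟨s, hs, rfl⟩, t, ht, rfl⟩, c, rfl, h⟩
          exact ⟨t * c, ⟨s, hs, a, rfl, by rw [← h]; group⟩, t, ht, c, rfl, rfl⟩
        · rintro ⟨_, ⟨s, hs, _, rfl, rfl⟩, t, ht, _, rfl, h⟩
          exact ⟨s⁻¹ * t, ⟨_, ⟨s, hs, rfl⟩, t, ht, rfl⟩, _, rfl, by rw [mul_assoc, h]; group⟩
      have haB : a ∉ B := by
        intro haB
        obtain ⟨t, ht⟩ := hT
        refine ha (Finset.mul_subset_mul_left (Finset.singleton_subset_iff.2 haB)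
          ((haT a).2 ⟨t * a, ?_, ?_⟩)) <;>
          exact Finset.mul_mem_mul ht (Finset.mem_singleton_self a)
      have hdisj : Disjoint (T * {a}) (T * B) := by
        rw [Finset.disjoint_left]
        intro x hx hx'
        obtain ⟨t, ht, b, hb, rfl⟩ := Finset.mem_mul.1 hx'
        refine ha (Finset.mul_subset_mul_left (Finset.singleton_subset_iff.2 hb)
          ((haT b).2 ⟨_, hx, ?_⟩))
        exact Finset.mul_mem_mul ht (Finset.mem_singleton_self b)
      refine ⟨insert a B, Finset.insert_subset_insert _ hB, ?_, ?_⟩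
      · rw [Finset.insert_eq, Finset.mul_union, Finset.card_union_of_disjoint hdisj, hc,
          Finset.card_union_of_disjoint (by simpa using haB), mul_add, Finset.mul_singleton]
        simp
      · refine Finset.insert_subset ?_ (hD.trans
          (Finset.mul_subset_mul_left (Finset.subset_insert _ _)))
        obtain ⟨t, ht⟩ := hT
        refine Finset.mul_subset_mul_left (Finset.singleton_subset_iff.2
          (Finset.mem_insert_self a B)) ((haT a).2 ⟨t * a, ?_, ?_⟩) <;>
          exact Finset.mul_mem_mul ht (Finset.mem_singleton_self a)

theorem mem_translates_congr {G : Type*} [Group G] {α : Type*} [MulAction G α] {C : Set α}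
    {x y : α} (h : ∀ g : G, g • x ∈ C ↔ g • y ∈ C) (L : Finset G) (g : G) :
    g • x ∈ translates L C ↔ g • y ∈ translates L C := by
  refine exists_congr fun l => and_congr_right fun _ => ?_
  rw [smul_smul, smul_smul]
  exact h _

/-! ### Erasing symbols near the marker. -/

namespace GSubshift

variable {G : Type v} [Group G]

open Classical in
/-- The local rule that records the visits to `C` and the symbols outside the translates of the
visit times by `L`. -/
noncomputable def eraseRule (X : GSubshift.{u, v} G) (C : Set X.carrier) (L : Finset G)
    (x : X.carrier) : ULift.{u} Bool × Option X.Alphabet :=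
  (⟨decide (x ∈ C)⟩, if x ∈ translates L C then none else some (x.1 1))

theorem eraseRule_eq_iff (X : GSubshift.{u, v} G) {C : Set X.carrier} {L : Finset G}
    {x y : X.carrier} : X.eraseRule C L x = X.eraseRule C L y ↔
      (x ∈ C ↔ y ∈ C) ∧ (x ∈ translates L C ↔ y ∈ translates L C) ∧
        (x ∉ translates L C → x.1 1 = y.1 1) := by
  classical
  simp only [eraseRule, Prod.mk.injEq, ULift.up.injEq, decide_eq_decide]
  refine and_congr_right fun _ => ?_
  by_cases hx : x ∈ translates L C <;> by_cases hy : y ∈ translates L C <;> simp [hx, hy]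

theorem isLocallyConstant_eraseRule (X : GSubshift.{u, v} G) {C : Set X.carrier}
    (hC : IsClopen C) (L : Finset G) : IsLocallyConstant (X.eraseRule C L) := by
  have hcl : ∀ {s : Set X.carrier}, IsClopen s → ∀ x, ∀ᶠ y in 𝓝 x, (y ∈ s ↔ x ∈ s) := by
    intro s hs x
    by_cases hx : x ∈ s
    · filter_upwards [hs.isOpen.mem_nhds hx] with y hy
      simp [hx, hy]
    · filter_upwards [hs.compl.isOpen.mem_nhds hx] with y hy
      exact iff_of_false hy hx
  rw [IsLocallyConstant.iff_eventually_eq]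
  intro x
  filter_upwards [hcl hC x, hcl (isClopen_translates L hC) x, X.eventually_pattern_eq {1} x]
    with y h1 h2 h3
  rw [eraseRule_eq_iff]
  exact ⟨h1, h2, fun _ => X.pattern_eq_iff.1 h3 1 (Finset.mem_singleton_self 1)⟩

/-- The factor of `X` given by `eraseRule`. -/
noncomputable abbrev eraseFactor (X : GSubshift.{u, v} G) {C : Set X.carrier}
    (hC : IsClopen C) (L : Finset G) : GSubshift.{u, v} G :=
  X.blockFactor (X.eraseRule C L) (X.isLocallyConstant_eraseRule hC L)

/-- The factor map given by `eraseRule`. -/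
noncomputable abbrev eraseMap (X : GSubshift.{u, v} G) {C : Set X.carrier}
    (hC : IsClopen C) (L : Finset G) : X.carrier → (X.eraseFactor hC L).carrier :=
  X.blockMap (X.eraseRule C L) (X.isLocallyConstant_eraseRule hC L)

theorem mem_iff_of_eraseMap_eq (X : GSubshift.{u, v} G) {C : Set X.carrier} {hC : IsClopen C}
    {L : Finset G} {x y : X.carrier} (h : X.eraseMap hC L x = X.eraseMap hC L y) (g : G) :
    g • x ∈ C ↔ g • y ∈ C :=
  (X.eraseRule_eq_iff.1 ((X.blockMap_eq_iff _).1 h g)).1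

theorem hasChain_of_eraseFactor_empty {ε : ℝ} (hε : 0 < ε) {X : GSubshift.{u, v} G}
    {C : Set X.carrier} (hC : IsClopen C) (h : HasChain ε (X.eraseFactor hC ∅)) :
    HasChain ε X := by
  refine h.cons_of_pattern_bound hε (X.isFactorMap_blockMap _ _) fun F _ =>
    Eventually.of_forall fun n y => ?_
  rw [zero_mul, Real.exp_zero, Nat.cast_le_one]
  refine (Set.ncard_le_one_iff (Set.toFinite _)).2 ?_
  rintro _ _ ⟨x, hx, rfl⟩ ⟨x', hx', rfl⟩
  have hxx' : X.eraseMap hC ∅ x = X.eraseMap hC ∅ x' := hx.trans hx'.symm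
  rw [pattern_eq_iff]
  intro g _
  have := (X.eraseRule_eq_iff.1 ((X.blockMap_eq_iff _).1 hxx' g)).2.2 (by simp [translates])
  simpa [smul_apply] using this

/-- Because visits to `C` are recorded, the code for `L` already knows which further positions the
code for `insert a L` erases. -/
theorem ker_eraseMap_insert [DecidableEq G] {X : GSubshift.{u, v} G} {C : Set X.carrier}
    {hC : IsClopen C} {L : Finset G} {a : G} {x y : X.carrier}
    (h : X.eraseMap hC L x = X.eraseMap hC L y) :
    X.eraseMap hC (insert a L) x = X.eraseMap hC (insert a L) y := by
  have hmem := X.mem_iff_of_eraseMap_eq h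
  rw [blockMap_eq_iff] at h ⊢
  intro g
  rw [eraseRule_eq_iff]
  refine ⟨hmem g, mem_translates_congr hmem _ g, fun hg => ?_⟩
  exact (X.eraseRule_eq_iff.1 (h g)).2.2 fun h' =>
    hg (translates_mono (Finset.subset_insert _ _) C h')

/-- Points in one fibre can differ only at positions `g` with `a⁻¹ * g` a visit to `C`, and `F n`
has at most about `2 |F n| / m` of these. -/
theorem HasChain.eraseFactor_of_insert [DecidableEq G] {ε β : ℝ} {X : GSubshift.{u, v} G}
    {C : Set X.carrier} {hC : IsClopen C} {m : ℕ} (hm : 0 < m) {K : Finset G}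
    (hK : IsPacked C m K) (hβ : 0 ≤ β)
    (hAβ : (Nat.card (ULift.{u} Bool × Option X.Alphabet) : ℝ) ≤ Real.exp β)
    (hε : 2 * β / m < ε) {L : Finset G} {a : G}
    (h : HasChain ε (X.eraseFactor hC (insert a L))) : HasChain ε (X.eraseFactor hC L) := by
  classical
  have hp := X.isFactorMap_blockMap (X.eraseRule C L) (X.isLocallyConstant_eraseRule hC L)
  have hq := X.isFactorMap_blockMap (X.eraseRule C (insert a L))
    (X.isLocallyConstant_eraseRule hC _)
  obtain ⟨π, hπ, hπq⟩ := exists_isFactorMap_of_ker_le hp hq fun x y =>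
    ker_eraseMap_insert (hC := hC)
  refine h.cons_of_pattern_bound hε hπ fun F hF => ?_
  filter_upwards [hF.eventually_card_mul_le (K * {a⁻¹})] with n hn y
  obtain ⟨x₀, rfl⟩ := hq.surjective y
  -- The visits are constant on the fibre, so `x₀` locates the newly erased positions for all of its
  -- points.
  let Q := (F n).filter fun g => (a⁻¹ * g) • x₀ ∈ C
  have h1 : ((X.eraseFactor hC L).pattern (F n) '' (π ⁻¹' {X.eraseMap hC (insert a L) x₀})).ncard
      ≤ ((X.eraseFactor hC L).pattern Q ''
        (π ⁻¹' {X.eraseMap hC (insert a L) x₀})).ncard := by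
    refine Set.ncard_image_le_of_factor (Set.toFinite _) fun z hz z' hz' hzz' => ?_
    obtain ⟨x, rfl⟩ := hp.surjective z
    obtain ⟨x', rfl⟩ := hp.surjective z'
    have hx : X.eraseMap hC (insert a L) x = X.eraseMap hC (insert a L) x₀ :=
      (hπq x).symm.trans hz
    have hx' : X.eraseMap hC (insert a L) x' = X.eraseMap hC (insert a L) x₀ :=
      (hπq x').symm.trans hz'
    have hm₀ := X.mem_iff_of_eraseMap_eq hx
    have hmm' := X.mem_iff_of_eraseMap_eq (hx.trans hx'.symm)
    have hxx' := (X.blockMap_eq_iff _).1 (hx.trans hx'.symm)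
    rw [pattern_eq_iff] at hzz' ⊢
    intro g hg
    by_cases hgQ : g ∈ Q
    · exact hzz' g hgQ
    · change X.eraseRule C L (g • x) = X.eraseRule C L (g • x')
      rw [eraseRule_eq_iff]
      refine ⟨hmm' g, mem_translates_congr hmm' _ g, fun hgx => ?_⟩
      refine (X.eraseRule_eq_iff.1 (hxx' g)).2.2 ?_
      rintro ⟨l, hl, hlx⟩
      rcases Finset.mem_insert.1 hl with rfl | hl
      · refine hgQ (Finset.mem_filter.2 ⟨hg, ?_⟩)
        rw [← hm₀, mul_smul]
        exact hlx
      · exact hgx ⟨l, hl, hlx⟩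
  have h2 : ((X.eraseFactor hC L).pattern Q ''
        (π ⁻¹' {X.eraseMap hC (insert a L) x₀})).ncard
      ≤ Nat.card (ULift.{u} Bool × Option X.Alphabet) ^ Q.card := by
    refine (Set.ncard_le_card _).trans_eq ?_
    rw [Nat.card_fun, Nat.card_eq_fintype_card (α := Q), Fintype.card_coe]
    rfl
  have h3 : m * Q.card ≤ ((K * {a⁻¹}) * F n).card := by
    rw [mul_assoc]
    refine le_trans ?_ (hK.mul_card_visits_le x₀ ({a⁻¹} * F n))
    refine Nat.mul_le_mul_left _ (Finset.card_le_card_of_injOn (a⁻¹ * ·) ?_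
      (mul_right_injective _).injOn)
    intro g hg
    have hg := Finset.mem_filter.1 hg
    exact Finset.mem_filter.2 ⟨Finset.mul_mem_mul (Finset.mem_singleton_self _) hg.1, hg.2⟩
  have hm' : (0 : ℝ) < m := Nat.cast_pos.2 hm
  have h3' : (m : ℝ) * Q.card ≤ 2 * (F n).card := by
    refine le_trans ?_ hn
    exact_mod_cast h3
  calc _ ≤ ((Nat.card (ULift.{u} Bool × Option X.Alphabet) : ℝ)) ^ Q.card := by
        exact_mod_cast h1.trans h2
    _ ≤ Real.exp β ^ Q.card := pow_le_pow_left₀ (Nat.cast_nonneg _) hAβ _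
    _ = Real.exp (Q.card * β) := by rw [← Real.exp_nat_mul]
    _ ≤ _ := by
      rw [Real.exp_le_exp, div_mul_eq_mul_div, le_div_iff₀ hm']
      nlinarith

theorem HasChain.of_eraseFactor [DecidableEq G] {ε β : ℝ} (hε' : 0 < ε)
    {X : GSubshift.{u, v} G} {C : Set X.carrier} {hC : IsClopen C} {m : ℕ} (hm : 0 < m)
    {K : Finset G} (hK : IsPacked C m K) (hβ : 0 ≤ β)
    (hAβ : (Nat.card (ULift.{u} Bool × Option X.Alphabet) : ℝ) ≤ Real.exp β)
    (hε : 2 * β / m < ε) (L : Finset G) (h : HasChain ε (X.eraseFactor hC L)) :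
    HasChain ε X := by
  induction L using Finset.induction_on with
  | empty => exact hasChain_of_eraseFactor_empty hε' hC h
  | insert a L _ ih => exact ih (h.eraseFactor_of_insert hm hK hβ hAβ hε)

end GSubshift

/-! ### The last factor and the choice of constants. -/

namespace GSubshift

variable {G : Type v} [Group G]

open Classical in
-- The set `V` fixes the visits in `F` (through `1`) and the erased positions of `F` (through
-- `L⁻¹`). Surviving positions are covered by windows `T⁻¹ * T * b` centred at surviving `b`, where
-- `hcov` allows only patterns from `A`; separation leaves at most `|T * F| / |T|` centres.
theorem ncard_pattern_eraseFactor_fiber_le (X : GSubshift.{u, v} G)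
    {C A : Set X.carrier} (hC : IsClopen C) {L T : Finset G} (hT : T.Nonempty)
    (hcov : ∀ x, x ∈ translates L C ∨ X.pattern (T⁻¹ * T) x ∈ X.pattern (T⁻¹ * T) '' A)
    {ν : ℝ} (hν : 0 ≤ ν) (hA : ((X.pattern (T⁻¹ * T) '' A).ncard : ℝ) ≤ Real.exp ν)
    (F V : Finset G) :
    ((((X.eraseFactor hC L).pattern F ∘ X.eraseMap hC L) ''
        {x | ((insert 1 L⁻¹) * F).filter (fun g => g • x ∈ C) = V}).ncard : ℝ)
      ≤ Real.exp (ν * (T * F).card / T.card) := by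
  have hTpos : (0 : ℝ) < T.card := by exact_mod_cast hT.card_pos
  set s : Set X.carrier := {x | ((insert 1 L⁻¹) * F).filter (fun g => g • x ∈ C) = V} with hs
  have hmem : ∀ x ∈ s, ∀ l ∈ insert 1 L⁻¹, ∀ g ∈ F, (l • g • x ∈ C ↔ l * g ∈ V) := by
    intro x hx l hl g hg
    have hx : ((insert 1 L⁻¹) * F).filter (fun g => g • x ∈ C) = V := hx
    rw [← hx, Finset.mem_filter, smul_smul]
    exact ⟨fun h => ⟨Finset.mul_mem_mul hl hg, h⟩, fun h => h.2⟩
  have htr : ∀ x ∈ s, ∀ g ∈ F, (g • x ∈ translates L C ↔ ∃ l ∈ L, l⁻¹ * g ∈ V) := by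
    intro x hx g hg
    refine exists_congr fun l => and_congr_right fun hl => hmem x hx l⁻¹ ?_ g hg
    exact Finset.mem_insert_of_mem (Finset.inv_mem_inv hl)
  obtain ⟨B, hBD, hBc, hB⟩ :=
    Finset.exists_separated hT (F.filter fun g => ¬ ∃ l ∈ L, l⁻¹ * g ∈ V)
  have h1 : (((X.eraseFactor hC L).pattern F ∘ X.eraseMap hC L) '' s).ncard
      ≤ ((fun x (b : B) => X.pattern (T⁻¹ * T) ((b : G) • x)) '' s).ncard := by
    refine Set.ncard_image_le_of_factor (Set.toFinite _) fun x hx x' hx' hxx' => ?_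
    change (X.eraseFactor hC L).pattern F (X.eraseMap hC L x)
      = (X.eraseFactor hC L).pattern F (X.eraseMap hC L x')
    rw [pattern_eq_iff]
    intro g hg
    change X.eraseRule C L (g • x) = X.eraseRule C L (g • x')
    rw [eraseRule_eq_iff, htr x hx g hg, htr x' hx' g hg]
    refine ⟨?_, Iff.rfl, fun hgV => ?_⟩
    · have e1 := hmem x hx 1 (Finset.mem_insert_self _ _) g hg
      have e2 := hmem x' hx' 1 (Finset.mem_insert_self _ _) g hg
      rw [one_smul] at e1 e2
      exact e1.trans e2.symm
    · obtain ⟨p, hp, b, hb, rfl⟩ := Finset.mem_mul.1 (hB (Finset.mem_filter.2 ⟨hg, hgV⟩))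
      have := X.pattern_eq_iff.1 (congrFun hxx' ⟨b, hb⟩) p hp
      simpa [smul_apply] using this
  have h2 : ((fun x (b : B) => X.pattern (T⁻¹ * T) ((b : G) • x)) '' s).ncard
      ≤ (X.pattern (T⁻¹ * T) '' A).ncard ^ B.card := by
    have hsub : (fun x (b : B) => X.pattern (T⁻¹ * T) ((b : G) • x)) '' s
        ⊆ Set.range fun (w : B → X.pattern (T⁻¹ * T) '' A) (b : B) => (w b).1 := by
      rintro _ ⟨x, hx, rfl⟩
      refine ⟨fun b => ⟨X.pattern (T⁻¹ * T) ((b : G) • x), ?_⟩, rfl⟩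
      have hbD := Finset.mem_filter.1 (hBD b.2)
      exact (hcov _).resolve_left fun h => hbD.2 ((htr x hx b hbD.1).1 h)
    refine (Set.ncard_le_ncard hsub (Set.toFinite _)).trans ?_
    rw [← Set.image_univ]
    refine (Set.ncard_image_le (Set.toFinite _)).trans_eq ?_
    rw [Set.ncard_univ, Nat.card_fun, Nat.card_coe_set_eq,
      Nat.card_eq_fintype_card (α := B), Fintype.card_coe]
  calc _ ≤ ((X.pattern (T⁻¹ * T) '' A).ncard : ℝ) ^ B.card := by exact_mod_cast h1.trans h2
    _ ≤ Real.exp ν ^ B.card := pow_le_pow_left₀ (Nat.cast_nonneg _) hA _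
    _ = Real.exp (B.card * ν) := by rw [← Real.exp_nat_mul]
    _ ≤ _ := by
      rw [Real.exp_le_exp, le_div_iff₀ hTpos]
      have h3 : T.card * B.card ≤ (T * F).card :=
        hBc.trans (Finset.card_le_card (Finset.mul_subset_mul_left (Finset.filter_subset _ _)))
      have h3 : (T.card : ℝ) * B.card ≤ (T * F).card := by exact_mod_cast h3
      nlinarith

open Classical in
-- The first two terms of `hε` count the sparse visit sets and the third the surviving symbols once
-- the visits are fixed; each factor `2` is the Følner bound for an enlarged set.
theorem hasChain_eraseFactor {ε ν l : ℝ} (X : GSubshift.{u, v} G) (hX : X.carrier.Nonempty)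
    {C A : Set X.carrier} (hC : IsClopen C) {m : ℕ} (hm : 0 < m) {K L T : Finset G}
    (hK : IsPacked C m K) (hT : T.Nonempty)
    (hcov : ∀ x, x ∈ translates L C ∨ X.pattern (T⁻¹ * T) x ∈ X.pattern (T⁻¹ * T) '' A)
    (hν : 0 ≤ ν) (hA : ((X.pattern (T⁻¹ * T) '' A).ncard : ℝ) ≤ Real.exp ν) (hl : 0 ≤ l)
    (hε : 2 * l / m + 2 * Real.exp (-l) + 2 * ν / T.card < ε) :
    HasChain ε (X.eraseFactor hC L) := by
  have hp := X.isFactorMap_blockMap (X.eraseRule C L) (X.isLocallyConstant_eraseRule hC L)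
  obtain ⟨x₀, hx₀⟩ := hX
  refine hasChain_of_pattern_bound hε ⟨_, (X.eraseMap hC L ⟨x₀, hx₀⟩).2⟩ fun F hF => ?_
  have hmpos : (0 : ℝ) < m := Nat.cast_pos.2 hm
  have hTpos : (0 : ℝ) < T.card := by exact_mod_cast hT.card_pos
  filter_upwards [hF.eventually_card_mul_le (K * insert 1 L⁻¹),
    hF.eventually_card_mul_le (insert 1 L⁻¹), hF.eventually_card_mul_le T] with n h1 h2 h3
  set F' := insert 1 L⁻¹ * F n with hF'
  let q : ℝ := (K * F').card / m
  let 𝒱 := F'.powerset.filter fun t => (t.card : ℝ) ≤ q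
  have hsub : (X.eraseFactor hC L).pattern (F n) '' Set.univ
      ⊆ ⋃ V ∈ 𝒱, ((X.eraseFactor hC L).pattern (F n) ∘ X.eraseMap hC L) ''
        {x | F'.filter (fun g => g • x ∈ C) = V} := by
    rintro _ ⟨z, -, rfl⟩
    obtain ⟨x, rfl⟩ := hp.surjective z
    refine Set.mem_biUnion (x := F'.filter (fun g => g • x ∈ C)) ?_ ⟨x, rfl, rfl⟩
    refine Finset.mem_filter.2 ⟨Finset.mem_powerset.2 (Finset.filter_subset _ _), ?_⟩
    rw [le_div_iff₀ hmpos, mul_comm]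
    exact_mod_cast hK.mul_card_visits_le x F'
  have hle : (((X.eraseFactor hC L).pattern (F n) '' Set.univ).ncard : ℝ)
      ≤ ∑ V ∈ 𝒱, ((((X.eraseFactor hC L).pattern (F n) ∘ X.eraseMap hC L) ''
        {x | F'.filter (fun g => g • x ∈ C) = V}).ncard : ℝ) := by
    exact_mod_cast (Set.ncard_le_ncard hsub (Set.toFinite _)).trans
      (Finset.set_ncard_biUnion_le _ _)
  have hcard : (𝒱.card : ℝ) ≤ Real.exp (l * q + F'.card * Real.exp (-l)) :=
    Finset.card_filter_card_le_le_exp F' q l hl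
  calc _ ≤ ∑ V ∈ 𝒱, Real.exp (ν * (T * F n).card / T.card) :=
        hle.trans (Finset.sum_le_sum fun V _ =>
          X.ncard_pattern_eraseFactor_fiber_le hC hT hcov hν hA (F n) V)
    _ = 𝒱.card * Real.exp (ν * (T * F n).card / T.card) := by
        rw [Finset.sum_const, nsmul_eq_mul]
    _ ≤ Real.exp (l * q + F'.card * Real.exp (-l))
          * Real.exp (ν * (T * F n).card / T.card) := by gcongr
    _ = Real.exp (l * q + F'.card * Real.exp (-l) + ν * (T * F n).card / T.card) := by
        rw [← Real.exp_add]
    _ ≤ _ := by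
      rw [Real.exp_le_exp]
      have e1 : l * q ≤ 2 * l / m * (F n).card := by
        have : ((K * F').card : ℝ) ≤ 2 * (F n).card := by rwa [hF', ← mul_assoc]
        calc l * q = l * (K * F').card / m := by simp only [q]; ring
          _ ≤ l * (2 * (F n).card) / m := by gcongr
          _ = _ := by ring
      have e2 : F'.card * Real.exp (-l) ≤ 2 * Real.exp (-l) * (F n).card := by
        nlinarith [Real.exp_pos (-l)]
      have e3 : ν * (T * F n).card / T.card ≤ 2 * ν / T.card * (F n).card := by
        calc ν * (T * F n).card / T.card ≤ ν * (2 * (F n).card) / T.card := by gcongr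
          _ = _ := by ring
      linarith

theorem hasChain [Infinite G] (X : GSubshift.{u, v} G) (hX : X.carrier.Nonempty) {ε : ℝ}
    (hε : 0 < ε) : HasChain ε X := by
  classical
  obtain ⟨l, hl0, hl⟩ : ∃ l : ℝ, 0 ≤ l ∧ 2 * Real.exp (-l) < ε / 4 := by
    have h : Tendsto (fun l : ℝ => 2 * Real.exp (-l)) atTop (𝓝 (2 * 0)) :=
      (Real.tendsto_exp_neg_atTop_nhds_zero).const_mul 2
    rw [mul_zero] at h
    obtain ⟨l, h1, h2⟩ :=
      ((eventually_ge_atTop 0).and (h.eventually_lt_const (by positivity : 0 < ε / 4))).exists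
    exact ⟨l, h1, h2⟩
  let b := Nat.card (ULift.{u} Bool × Option X.Alphabet)
  have hbexp : ∀ k : ℕ, (k : ℝ) ≤ Real.exp k := fun k => by linarith [Real.add_one_le_exp (k : ℝ)]
  obtain ⟨m, hm, hm1, hm2⟩ : ∃ m : ℕ, 0 < m ∧ 2 * (b : ℝ) / m < ε ∧ 2 * l / m < ε / 4 := by
    have h1 := tendsto_const_div_atTop_nhds_zero_nat (2 * (b : ℝ))
    have h2 := tendsto_const_div_atTop_nhds_zero_nat (2 * l)
    obtain ⟨m, h⟩ := ((eventually_gt_atTop 0).and ((h1.eventually_lt_const hε).and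
      (h2.eventually_lt_const (by positivity : 0 < ε / 4)))).exists
    exact ⟨m, h⟩
  let c₁ : ℕ := m ^ m * m ^ m
  let c₂ : ℕ := Nat.card X.Alphabet ^ m * m
  -- The numerator bounds the logarithm of the number of small-orbit patterns, using `k ≤ exp k`,
  -- and is linear in `r`; the denominator will be `T.card`.
  obtain ⟨r, hr⟩ : ∃ r : ℕ, 2 * ((r : ℝ) * c₁ + c₂) / (2 ^ r : ℝ) < ε / 4 := by
    have h1 : Tendsto (fun r : ℕ => (r : ℝ) / 2 ^ r) atTop (𝓝 0) := by
      simpa using tendsto_pow_const_div_const_pow_of_one_lt 1 (one_lt_two : (1 : ℝ) < 2)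
    have h2 : Tendsto (fun r : ℕ => (1 : ℝ) / 2 ^ r) atTop (𝓝 0) := by
      simpa using tendsto_pow_const_div_const_pow_of_one_lt 0 (one_lt_two : (1 : ℝ) < 2)
    have h3 := (h1.const_mul (2 * (c₁ : ℝ))).add (h2.const_mul (2 * (c₂ : ℝ)))
    rw [mul_zero, mul_zero, add_zero] at h3
    obtain ⟨r, hr⟩ := (h3.eventually_lt_const (by positivity : 0 < ε / 4)).exists
    refine ⟨r, lt_of_eq_of_lt ?_ hr⟩
    ring
  obtain ⟨S, T, hS, hTS, hTc⟩ := exists_card_eq_two_pow_subset_closure G r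
  have hT : T.Nonempty := Finset.card_pos.1 (hTc ▸ by positivity)
  have hPS : ((T⁻¹ * T : Finset G) : Set G) ⊆ Subgroup.closure (S : Set G) := by
    intro g hg
    obtain ⟨t, ht, t', ht', rfl⟩ := Finset.mem_mul.1 (Finset.mem_coe.1 hg)
    obtain ⟨s, hs, rfl⟩ := Finset.mem_inv.1 ht
    exact mul_mem (inv_mem (hTS hs)) (hTS ht')
  have hA : ((X.pattern (T⁻¹ * T) '' X.smallOrbits m).ncard : ℝ)
      ≤ Real.exp ((r : ℝ) * c₁ + c₂) := by
    have h1 : (X.pattern (T⁻¹ * T) '' X.smallOrbits m).ncard ≤ c₁ ^ r * c₂ := by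
      refine (X.ncard_pattern_smallOrbits_le hm hPS).trans ?_
      rw [← mul_pow]
      exact Nat.mul_le_mul_right _ (Nat.pow_le_pow_right (by positivity) hS)
    calc ((X.pattern (T⁻¹ * T) '' X.smallOrbits m).ncard : ℝ) ≤ (c₁ : ℝ) ^ r * c₂ := by
          exact_mod_cast h1
      _ ≤ Real.exp c₁ ^ r * Real.exp c₂ := by
          gcongr
          · exact hbexp _
          · exact hbexp _
      _ = _ := by rw [← Real.exp_nat_mul, ← Real.exp_add]
  -- Membership depends on a finite window, so `U` is an open neighbourhood of the small orbits; its
  -- complement is compact and consists of points with at least `m` orbit elements, as the marker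
  -- requires.
  let U : Set X.carrier := {x | X.pattern (T⁻¹ * T) x ∈ X.pattern (T⁻¹ * T) '' X.smallOrbits m}
  have hU : IsOpen U := by
    refine isOpen_iff_mem_nhds.2 fun x hx => ?_
    filter_upwards [X.eventually_pattern_eq (T⁻¹ * T) x] with y hy
    rw [Set.mem_ofPred_eq, hy]
    exact hx
  obtain ⟨C, K, L, hC, hK, hL⟩ := X.exists_marker m hU.isClosed_compl.isCompact fun x hx => by
    by_contra hcon
    exact hx ⟨x, hcon, rfl⟩
  have hcov : ∀ x, x ∈ translates L C ∨
      X.pattern (T⁻¹ * T) x ∈ X.pattern (T⁻¹ * T) '' X.smallOrbits m := by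
    intro x
    by_cases hx : x ∈ U
    · exact Or.inr hx
    · exact Or.inl (hL hx)
  refine HasChain.of_eraseFactor (hC := hC) hε hm hK (Nat.cast_nonneg b) (hbexp b) hm1 L ?_
  refine X.hasChain_eraseFactor hX hC hm hK hT hcov (by positivity) hA hl0 ?_
  rw [hTc]
  push_cast
  linarith

end GSubshift

theorem proposition5p1 {G : Type v} [Group G] [Countable G] [Infinite G]
    (hG : IsAmenableGroup G) (X : GSubshift.{u, v} G) (hX : X.carrier.Nonempty)
    (ε : ℝ) (hε : ε ∈ Set.Ioo (0 : ℝ) (1 / 2)) :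
    ∃ (M : ℕ) (Z : Fin (M + 2) → GSubshift.{u, v} G)
      (φ : ∀ m : Fin (M + 1), (Z m.castSucc).carrier → (Z m.succ).carrier),
      Z 0 = X ∧
      (∃ p, (Z (Fin.last (M + 1))).carrier = {p}) ∧
      (∀ m, IsFactorMap G (φ m)) ∧
      ∀ m, ∀ F : ℕ → Finset G, IsFolnerSeq F → condEntropy F (φ m) < (ε : EReal) :=
  X.hasChain hX hε.1
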